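/- Let $X\subset\mathbb{R}^d$ be compact, let $c:X\times X\to[0,\infty)$ be a symmetric Lipschitz cost with $c(x,x)=0$ for all $x$, and let $\varepsilon>0$. For finite Borel measures $\alpha,\beta$ on $X$ let $\Pi(\alpha,\beta)$ be the set of measures on $X\times X$ with marginals $\alpha$ and $\beta$. For measures $\pi,\nu$ put $\mathrm{KL}(\pi\,|\,\nu)=\int\varphi\!\left(\frac{d\pi}{d\nu}\right)d\nu$ with $\varphi(p)=p\log p-p+1$ if $\pi\ll\nu$, and $\mathrm{KL}(\pi\,|\,\nu)=+\infty$ otherwise. Define $$\mathrm{OT}_\varepsilon(\alpha,\beta)=\inf_{\pi\in\Pi(\alpha,\beta)}\int c\,d\pi+\varepsilon\,\mathrm{KL}(\pi\,|\,\alpha\otimes\beta),$$ $$\mathrm{Sk}_\varepsilon(\alpha,\beta)=\mathrm{OT}_\varepsilon(\alpha,\beta)-\tfrac12\mathrm{OT}_\varepsilon(\alpha,\alpha)-\tfrac12\mathrm{OT}_\varepsilon(\beta,\beta).$$ A minimizer $\pi$ of the first problem is called an optimal transport plan for $(\alpha,\beta)$, and a couple $(f,g)$ of continuous functions on $X$ that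 maximizes $$\int f\,d\alpha+\int g\,d\beta-\varepsilon\iint\Big(e^{(f(x)+g(y)-c(x,y))/\varepsilon}-1\Big)\,d\alpha(x)\,d\beta(y)$$ over all such couples is called a couple of optimal potentials for $(\alpha,\beta)$. Let $\alpha,\beta$ be finite Borel measures on $X$ with the same total mass $\alpha(X)=\beta(X)=m$. Then for every real $\lambda>0$: 1. If $(f,g)$ is a couple of optimal potentials for $(\alpha,\beta)$, then $(f-\varepsilon\log\lambda,\;g)$ is a couple of optimal potentials for $(\lambda\alpha,\lambda\beta)$. 2. If $\pi$ is an optimal transport plan for $(\alpha,\beta)$, then $\lambda\pi$ is an optimal transport plan for $(\lambda\alpha,\lambda\beta)$. 3. The costs $\mathrm{OT}_\varepsilon(\lambda\alpha,\lambda\beta)$, $\mathrm{OT}_\varepsilon(\lambda\alpha,\lambda\alpha)$ and $\mathrm{OT}_\varepsilon(\lambda\beta,\lambda\beta)$ are finite, and $$\mathrm{OT}_\varepsilon(\lambda\alpha,\lambda\beta)=\lambda\,\mathrm{OT}_\varepsilon(\alpha,\beta)+\varepsilon\lambda(\lambda-1)m^2-\varepsilon\log(\lambda)\,\lambda\,m.$$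 In particular the cost is not homogeneous: if $m>0$, there is some $\lambda>0$ with $\mathrm{OT}_\varepsilon(\lambda\alpha,\lambda\beta)\neq\lambda\,\mathrm{OT}_\varepsilon(\alpha,\beta)$. 4. The Sinkhorn divergence is homogeneous: $\mathrm{Sk}_\varepsilon(\lambda\alpha,\lambda\beta)=\lambda\,\mathrm{Sk}_\varepsilon(\alpha,\beta)$. -/

import Mathlib

open MeasureTheory InformationTheory
open scoped NNReal ENNReal

namespace EntropicOT

noncomputable section

/-- The set `Π(α, β)` of transport plans: measures on `X × X` with marginals `α` and `β`. -/
def transportPlans {X : Type*} [MeasurableSpace X] (α β : Measure X) : Set (Measure (X × X)) :=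
  {π | π.fst = α ∧ π.snd = β}

/-- The primal objective `⟨π, c⟩ + ε KL(π | α ⊗ β)`. Mathlib's `klDiv π ν` is the divergence of
`φ(p) = p log p - p + 1`, that is `∫ φ(dπ/dν) dν` if `π ≪ ν`, and `∞` otherwise. -/
def primalObjective {X : Type*} [MeasurableSpace X] (c : X → X → ℝ≥0) (ε : ℝ) (α β : Measure X)
    (π : Measure (X × X)) : ℝ≥0∞ :=
  ∫⁻ p, (c p.1 p.2 : ℝ≥0∞) ∂π + ENNReal.ofReal ε * klDiv π (α.prod β)

/-- The infimum of the primal problem, as an extended nonnegative number. -/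
def primalValue {X : Type*} [MeasurableSpace X] (c : X → X → ℝ≥0) (ε : ℝ) (α β : Measure X) :
    ℝ≥0∞ :=
  ⨅ π ∈ transportPlans α β, primalObjective c ε α β π

/-- The cost `OT_ε(α, β)` as a real number (meaningful when `primalValue` is finite). -/
def cost {X : Type*} [MeasurableSpace X] (c : X → X → ℝ≥0) (ε : ℝ) (α β : Measure X) : ℝ :=
  (primalValue c ε α β).toReal

/-- `π` is an optimal transport plan: a minimizer of the primal problem. -/
def IsOptimalPlan {X : Type*} [MeasurableSpace X] (c : X → X → ℝ≥0) (ε : ℝ) (α β : Measure X)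
    (π : Measure (X × X)) : Prop :=
  π ∈ transportPlans α β ∧
    ∀ π' ∈ transportPlans α β, primalObjective c ε α β π ≤ primalObjective c ε α β π'

/-- The dual objective `⟨f, α⟩ + ⟨g, β⟩ - ε ⟨exp((f ⊕ g - c) / ε) - 1, α ⊗ β⟩`. -/
def dualObjective {X : Type*} [MeasurableSpace X] [TopologicalSpace X] (c : X → X → ℝ≥0) (ε : ℝ)
    (α β : Measure X) (f g : C(X, ℝ)) : ℝ :=
  ∫ x, f x ∂α + ∫ y, g y ∂β
    - ε * ∫ p, (Real.exp ((f p.1 + g p.2 - (c p.1 p.2 : ℝ)) / ε) - 1) ∂(α.prod β)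

/-- `(f, g)` is a couple of optimal potentials: a maximizer of the dual problem over
continuous functions. -/
def IsOptimalPotentials {X : Type*} [MeasurableSpace X] [TopologicalSpace X] (c : X → X → ℝ≥0)
    (ε : ℝ) (α β : Measure X) (f g : C(X, ℝ)) : Prop :=
  ∀ f' g' : C(X, ℝ), dualObjective c ε α β f' g' ≤ dualObjective c ε α β f g

/-- The balanced Sinkhorn divergence `Sk_ε(α, β)`. -/
def sinkhornDivergence {X : Type*} [MeasurableSpace X] (c : X → X → ℝ≥0) (ε : ℝ)
    (α β : Measure X) : ℝ :=
  cost c ε α β - (1 / 2) * cost c ε α α - (1 / 2) * cost c ε β β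

end

end EntropicOT

namespace EntropicOT

/-! Multiplication by `s` is a bijection from plans for `(α, β)` to plans for `(sα, sβ)`, while the
reference measure becomes `s² α ⊗ β`. One factor `s` comes out of KL by joint homogeneity; the other
adds `(s - 1) m² - m log s`, which is the same for every plan because every plan has mass `m`. So
the objective changes by a factor `s` and a constant (`primalObjective_smul_add`), which preserves
minimizers. On the dual side, lowering `f` by `ε log s` absorbs the extra factor `s`
(`dualObjective_smul`). The constant depends only on `m`, so it cancels in the Sinkhorn divergence,
with weights `1 - 1/2 - 1/2`. -/

/-- Scaling the reference measure shifts the Kullback-Leibler divergence by a real constant,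
whose positive and negative parts are kept on the two sides of the equation. -/
theorem klDiv_smul_right_add {Ω : Type*} [MeasurableSpace Ω] (μ ν : Measure Ω)
    [IsFiniteMeasure μ] [IsFiniteMeasure ν] {s : ℝ≥0} (hs : s ≠ 0) {k : ℝ}
    (hk : k = (s - 1) * ν.real Set.univ - Real.log s * μ.real Set.univ) :
    klDiv μ (s • ν) + ENNReal.ofReal (-k) = klDiv μ ν + ENNReal.ofReal k := by
  have hac : μ ≪ s • ν ↔ μ ≪ ν := by
    rw [← Measure.coe_nnreal_smul]
    exact ⟨fun h => h.trans Measure.smul_absolutelyContinuous,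
      fun h => h.trans (Measure.absolutelyContinuous_smul (by simpa using hs))⟩
  by_cases h : klDiv μ ν = ∞
  · have h' : klDiv μ (s • ν) = ∞ := by
      rw [klDiv_eq_top_iff] at h ⊢
      intro hac' hint
      have hμν := hac.1 hac'
      refine h hμν ?_
      -- The log-likelihood ratio only moves by the constant `log s`, which is integrable since `μ`
      -- is finite.
      rw [integrable_congr (llr_smul_nnreal_right hμν s hs)] at hint
      refine (hint.add (integrable_const (Real.log s))).congr (Filter.Eventually.of_forall fun x => ?_)
      simp
    simp [h, h']
  · obtain ⟨hμν, hint⟩ := klDiv_ne_top_iff.1 h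
    have h' : klDiv μ (s • ν) ≠ ∞ := by
      refine klDiv_ne_top (hac.2 hμν) ?_
      rw [integrable_congr (llr_smul_nnreal_right hμν s hs)]
      exact hint.sub (integrable_const _)
    have key := toReal_klDiv_smul_right hμν hint hs
    rw [← ENNReal.toReal_eq_toReal_iff' (by simp [h']) (by simp [h]),
      ENNReal.toReal_add h' (by simp), ENNReal.toReal_add h (by simp),
      ENNReal.toReal_ofReal', ENNReal.toReal_ofReal', key]
    have := max_zero_sub_max_neg_zero_eq_self k
    linarith

/-! ### Scaling of the primal problem. -/

section Scaling

variable {X : Type*} [MeasurableSpace X]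

theorem smul_mem_transportPlans {α β : Measure X} {π : Measure (X × X)} (s : ℝ≥0)
    (hπ : π ∈ transportPlans α β) : s • π ∈ transportPlans (s • α) (s • β) := by
  obtain ⟨h₁, h₂⟩ := hπ
  constructor
  · rw [← h₁, Measure.fst, Measure.fst, Measure.map_smul]
  · rw [← h₂, Measure.snd, Measure.snd, Measure.map_smul]

theorem exists_smul_eq_of_mem_transportPlans {α β : Measure X} {s : ℝ≥0} (hs : s ≠ 0)
    {π : Measure (X × X)} (hπ : π ∈ transportPlans (s • α) (s • β)) :
    ∃ π' ∈ transportPlans α β, s • π' = π := by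
  refine ⟨s⁻¹ • π, ?_, by rw [smul_smul, mul_inv_cancel₀ hs, one_smul]⟩
  simpa only [smul_smul, inv_mul_cancel₀ hs, one_smul] using smul_mem_transportPlans s⁻¹ hπ

theorem smul_prod_smul (α β : Measure X) [SFinite β] (s : ℝ≥0) :
    (s • α).prod (s • β) = s • s • α.prod β := by
  rw [Measure.prod_smul_left, Measure.prod_smul_right]

/-- The real constant `ε s (s - 1) m² - ε s m log s` by which the entropic costs of measures of
mass `m` fail to be homogeneous. -/
noncomputable def scalingDefect (ε m : ℝ) (s : ℝ≥0) : ℝ :=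
  ε * s * (s - 1) * m ^ 2 - ε * Real.log s * s * m

variable (c : X → X → ℝ≥0) {ε : ℝ} {α β : Measure X} [IsFiniteMeasure α] [IsFiniteMeasure β]
  {m : ℝ} {s : ℝ≥0}

/-- The defect has no fixed sign and the objectives may be infinite, so its positive and negative
parts sit on opposite sides. -/
theorem primalObjective_smul_add (hε : 0 ≤ ε) (hs : s ≠ 0)
    (hα : α.real Set.univ = m) (hβ : β.real Set.univ = m) {π : Measure (X × X)}
    (hπ : π ∈ transportPlans α β) :
    primalObjective c ε (s • α) (s • β) (s • π) + ENNReal.ofReal (-scalingDefect ε m s) =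
      s * primalObjective c ε α β π + ENNReal.ofReal (scalingDefect ε m s) := by
  have hπu : π Set.univ = α Set.univ := by rw [← hπ.1, Measure.fst_univ]
  have : IsFiniteMeasure π := ⟨by rw [hπu]; exact measure_lt_top _ _⟩
  have hπm : π.real Set.univ = m := by rw [← hα, measureReal_def, measureReal_def, hπu]
  have hνm : (α.prod β).real Set.univ = m * m := by
    rw [← Set.univ_prod_univ, measureReal_prod_prod, hα, hβ]
  have key := klDiv_smul_right_add π (α.prod β) hs (k := (s - 1) * (m * m) - Real.log s * m)
    (by rw [hπm, hνm])
  have hpos : 0 ≤ ε * s := by positivity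
  have e₁ : ENNReal.ofReal (scalingDefect ε m s) =
      s * (ENNReal.ofReal ε * ENNReal.ofReal ((s - 1) * (m * m) - Real.log s * m)) := by
    rw [← mul_assoc, mul_comm (s : ℝ≥0∞), ← ENNReal.ofReal_coe_nnreal (p := s),
      ← ENNReal.ofReal_mul hε, ← ENNReal.ofReal_mul hpos, scalingDefect]
    ring_nf
  have e₂ : ENNReal.ofReal (-scalingDefect ε m s) =
      s * (ENNReal.ofReal ε * ENNReal.ofReal (-((s - 1) * (m * m) - Real.log s * m))) := by
    rw [← mul_assoc, mul_comm (s : ℝ≥0∞), ← ENNReal.ofReal_coe_nnreal (p := s),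
      ← ENNReal.ofReal_mul hε, ← ENNReal.ofReal_mul hpos, scalingDefect]
    ring_nf
  rw [e₁, e₂, primalObjective, primalObjective, smul_prod_smul, klDiv_smul_same,
    lintegral_smul_measure, ENNReal.smul_def, smul_eq_mul, mul_left_comm (ENNReal.ofReal ε),
    ← mul_add, ← mul_add, ← mul_add, add_assoc, add_assoc, ← mul_add, ← mul_add, key]

theorem primalValue_smul_add (hε : 0 ≤ ε) (hs : s ≠ 0)
    (hα : α.real Set.univ = m) (hβ : β.real Set.univ = m) :
    primalValue c ε (s • α) (s • β) + ENNReal.ofReal (-scalingDefect ε m s) =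
      s * primalValue c ε α β + ENNReal.ofReal (scalingDefect ε m s) := by
  have hs₀ : (s : ℝ≥0∞) ≠ 0 := by simpa using hs
  simp only [primalValue, ENNReal.iInf_add, ENNReal.mul_iInf_of_ne hs₀ ENNReal.coe_ne_top]
  refine le_antisymm (le_iInf₂ fun π hπ => ?_) (le_iInf₂ fun π hπ => ?_)
  · rw [← primalObjective_smul_add c hε hs hα hβ hπ]
    exact iInf₂_le (s • π) (smul_mem_transportPlans s hπ)
  · obtain ⟨π', hπ', rfl⟩ := exists_smul_eq_of_mem_transportPlans hs hπ
    rw [primalObjective_smul_add c hε hs hα hβ hπ']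
    exact iInf₂_le π' hπ'

theorem IsOptimalPlan.smul (hε : 0 ≤ ε) (hs : s ≠ 0)
    (hα : α.real Set.univ = m) (hβ : β.real Set.univ = m) {π : Measure (X × X)}
    (hπ : IsOptimalPlan c ε α β π) : IsOptimalPlan c ε (s • α) (s • β) (s • π) := by
  refine ⟨smul_mem_transportPlans s hπ.1, fun π' hπ' => ?_⟩
  obtain ⟨π'', hπ'', rfl⟩ := exists_smul_eq_of_mem_transportPlans hs hπ'
  rw [← ENNReal.add_le_add_iff_right (a := ENNReal.ofReal (-scalingDefect ε m s))
      ENNReal.ofReal_ne_top, primalObjective_smul_add c hε hs hα hβ hπ.1,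
    primalObjective_smul_add c hε hs hα hβ hπ'']
  gcongr
  exact hπ.2 π'' hπ''

theorem cost_smul (hε : 0 ≤ ε) (hs : s ≠ 0)
    (hα : α.real Set.univ = m) (hβ : β.real Set.univ = m)
    (hfin : primalValue c ε α β ≠ ∞) :
    cost c ε (s • α) (s • β) = s * cost c ε α β + scalingDefect ε m s := by
  have key := primalValue_smul_add c hε hs hα hβ
  have hr : (s : ℝ≥0∞) * primalValue c ε α β ≠ ∞ := ENNReal.mul_ne_top ENNReal.coe_ne_top hfin
  have hl : primalValue c ε (s • α) (s • β) ≠ ∞ := by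
    intro h
    rw [h, top_add] at key
    exact ENNReal.add_ne_top.2 ⟨hr, ENNReal.ofReal_ne_top⟩ key.symm
  have := congrArg ENNReal.toReal key
  rw [ENNReal.toReal_add hl (by simp), ENNReal.toReal_add hr (by simp), ENNReal.toReal_mul,
    ENNReal.coe_toReal, ENNReal.toReal_ofReal', ENNReal.toReal_ofReal'] at this
  have := max_zero_sub_max_neg_zero_eq_self (scalingDefect ε m s)
  simp only [cost]
  linarith

/-- The normalized product measure is a plan of finite cost when the ground cost is bounded. -/
theorem primalValue_ne_top {C : ℝ≥0} (hc : ∀ x y, c x y ≤ C)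
    (hα : α.real Set.univ = m) (hβ : β.real Set.univ = m) : primalValue c ε α β ≠ ∞ := by
  suffices ∃ π ∈ transportPlans α β, IsFiniteMeasure π ∧ klDiv π (α.prod β) ≠ ∞ by
    obtain ⟨π, hπ, hfin, hkl⟩ := this
    refine ne_top_of_le_ne_top ?_ (iInf₂_le π hπ)
    refine ENNReal.add_ne_top.2 ⟨?_, ENNReal.mul_ne_top ENNReal.ofReal_ne_top hkl⟩
    refine ne_top_of_le_ne_top (ENNReal.mul_ne_top ENNReal.coe_ne_top (measure_ne_top π Set.univ))
      ((lintegral_mono fun p => ?_).trans (lintegral_const (C : ℝ≥0∞)).le)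
    exact ENNReal.coe_le_coe.2 (hc p.1 p.2)
  have hmass : ∀ μ : Measure X, IsFiniteMeasure μ → μ.real Set.univ = m →
      μ Set.univ = (m.toNNReal : ℝ≥0∞) := by
    intro μ _ h
    rw [← h, measureReal_def, ENNReal.toNNReal_toReal_eq, ENNReal.coe_toNNReal (measure_ne_top _ _)]
  have hα' := hmass α inferInstance hα
  have hβ' := hmass β inferInstance hβ
  set t : ℝ≥0 := m.toNNReal
  -- Normalizing by `t⁻¹` needs positive mass; at mass zero the zero plan serves.
  by_cases ht : t = 0
  · have hα₀ : α = 0 := by simpa [ht] using hα'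
    have hβ₀ : β = 0 := by simpa [ht] using hβ'
    subst hα₀ hβ₀
    exact ⟨0, by simp [transportPlans], inferInstance, by simp⟩
  · refine ⟨t⁻¹ • α.prod β, ⟨?_, ?_⟩, inferInstance, ?_⟩
    · rw [Measure.fst, Measure.map_smul, Measure.map_fst_prod, hβ', Measure.coe_nnreal_smul,
        smul_smul, inv_mul_cancel₀ ht, one_smul]
    · rw [Measure.snd, Measure.map_smul, Measure.map_snd_prod, hα', Measure.coe_nnreal_smul,
        smul_smul, inv_mul_cancel₀ ht, one_smul]
    -- With `ν = α ⊗ β`, writing `ν = t⁻¹ (t ν)` reduces the claim to finiteness of `KL(ν | t ν)`, a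
    -- finite shift of `KL(ν | ν) = 0`.
    · have h := klDiv_smul_same (μ := α.prod β) (ν := t • α.prod β) t⁻¹
      rw [smul_smul, inv_mul_cancel₀ ht, one_smul] at h
      rw [h]
      refine ENNReal.mul_ne_top ENNReal.coe_ne_top fun htop => ?_
      have := klDiv_smul_right_add (α.prod β) (α.prod β) ht rfl
      rw [htop, klDiv_self, zero_add, top_add] at this
      exact ENNReal.ofReal_ne_top this.symm

end Scaling

theorem exists_scalingDefect_ne_zero {ε m : ℝ} (hε : 0 < ε) (hm : 0 < m) :
    ∃ s : ℝ≥0, 0 < s ∧ scalingDefect ε m s ≠ 0 := by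
  have hlog : 0 < Real.log 2 := Real.log_pos one_lt_two
  have hlog₄ : Real.log 4 = 2 * Real.log 2 := by
    rw [show (4 : ℝ) = 2 ^ 2 by norm_num, Real.log_pow]
    norm_num
  have hfactor : ∀ s : ℝ≥0, scalingDefect ε m s = ε * s * m * ((s - 1) * m - Real.log s) := by
    intro s
    rw [scalingDefect]
    ring
  -- Vanishing at `s = 2` and `s = 4` would give `m = log 2` and `3 m = 2 log 2`.
  by_contra! h
  have h₂ := h 2 two_pos
  have h₄ := h 4 four_pos
  simp only [hfactor, mul_eq_zero, hε.ne', hm.ne', NNReal.coe_ofNat, OfNat.ofNat_ne_zero,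
    or_self, false_or, hlog₄] at h₂ h₄
  linarith

/-! ### Scaling of the dual problem. -/

/-- The shift divides the exponential by `s`, cancelling one factor of `s²`. The defect collects `-ε
s m log s` from the linear term and `ε (s² - s) m²` from the `-1` beside the exponential. -/
theorem dualObjective_smul {X : Type*} [MeasurableSpace X] [TopologicalSpace X]
    [SecondCountableTopology X] [CompactSpace X] [BorelSpace X] {c : X → X → ℝ≥0}
    (hc : Continuous fun p : X × X => c p.1 p.2) {ε : ℝ} (hε : ε ≠ 0)
    {α β : Measure X} [IsFiniteMeasure α] [IsFiniteMeasure β] {m : ℝ}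
    (hα : α.real Set.univ = m) (hβ : β.real Set.univ = m) {s : ℝ≥0} (hs : 0 < s)
    (f g : C(X, ℝ)) :
    dualObjective c ε (s • α) (s • β) (f - ContinuousMap.const X (ε * Real.log s)) g =
      s * dualObjective c ε α β f g + scalingDefect ε m s := by
  have hs' : (0 : ℝ) < s := by exact_mod_cast hs
  have hint : ∀ (μ : Measure X) [IsFiniteMeasure μ] (h : C(X, ℝ)), Integrable h μ :=
    fun μ _ h => h.continuous.integrable_of_hasCompactSupport (HasCompactSupport.of_compactSpace _)
  have hcont : Continuous fun p : X × X => Real.exp ((f p.1 + g p.2 - (c p.1 p.2 : ℝ)) / ε) := by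
    fun_prop
  have hexp : Integrable (fun p : X × X => Real.exp ((f p.1 + g p.2 - (c p.1 p.2 : ℝ)) / ε))
      (α.prod β) :=
    hcont.integrable_of_hasCompactSupport (HasCompactSupport.of_compactSpace _)
  have hνm : (α.prod β).real Set.univ = m * m := by
    rw [← Set.univ_prod_univ, measureReal_prod_prod, hα, hβ]
  have hshift : ∀ p : X × X, Real.exp (((f - ContinuousMap.const X (ε * Real.log s)) p.1 + g p.2
      - (c p.1 p.2 : ℝ)) / ε) = (s : ℝ)⁻¹ * Real.exp ((f p.1 + g p.2 - (c p.1 p.2 : ℝ)) / ε) := by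
    intro p
    rw [← Real.exp_log (inv_pos.2 hs'), ← Real.exp_add, Real.log_inv]
    congr 1
    simp only [ContinuousMap.sub_apply, ContinuousMap.const_apply]
    field_simp
    ring
  simp only [dualObjective, smul_prod_smul, integral_smul_nnreal_measure, hshift]
  rw [integral_sub (hexp.const_mul _) (integrable_const _), integral_const_mul,
    integral_sub hexp (integrable_const _)]
  simp only [ContinuousMap.sub_apply, ContinuousMap.const_apply]
  rw [integral_sub (hint α f) (integrable_const _)]
  simp only [integral_const, hα, hνm, smul_eq_mul, NNReal.smul_def, scalingDefect]
  field_simp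
  ring

theorem IsOptimalPotentials.smul {X : Type*} [MeasurableSpace X] [TopologicalSpace X]
    [SecondCountableTopology X] [CompactSpace X] [BorelSpace X] {c : X → X → ℝ≥0}
    (hc : Continuous fun p : X × X => c p.1 p.2) {ε : ℝ} (hε : ε ≠ 0)
    {α β : Measure X} [IsFiniteMeasure α] [IsFiniteMeasure β] {m : ℝ}
    (hα : α.real Set.univ = m) (hβ : β.real Set.univ = m) {s : ℝ≥0} (hs : 0 < s)
    {f g : C(X, ℝ)} (h : IsOptimalPotentials c ε α β f g) :
    IsOptimalPotentials c ε (s • α) (s • β) (f - ContinuousMap.const X (ε * Real.log s)) g := by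
  intro f' g'
  -- Any competitor `f'` is the shift of `f' + ε log s`, so it too falls under the scaling identity.
  rw [dualObjective_smul hc hε hα hβ hs,
    ← add_sub_cancel_right f' (ContinuousMap.const X (ε * Real.log s)),
    dualObjective_smul hc hε hα hβ hs]
  gcongr
  exact h _ _

end EntropicOT

theorem mainTheorem5 {d : ℕ} (X : Set (EuclideanSpace ℝ (Fin d))) (hX : IsCompact X)
    (c : X → X → ℝ≥0) (hc_diag : ∀ x, c x x = 0) (hc_symm : ∀ x y, c x y = c y x)
    (hc_lip : ∃ K : ℝ≥0, LipschitzWith K (fun p : X × X => c p.1 p.2))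
    (ε : ℝ) (hε : 0 < ε)
    (α β : Measure X) [IsFiniteMeasure α] [IsFiniteMeasure β]
    (m : ℝ) (hα : α.real Set.univ = m) (hβ : β.real Set.univ = m) :
    -- optimal potentials
    (∀ s : ℝ≥0, 0 < s → ∀ f g : C(X, ℝ), EntropicOT.IsOptimalPotentials c ε α β f g →
      EntropicOT.IsOptimalPotentials c ε (s • α) (s • β)
        (f - ContinuousMap.const X (ε * Real.log s)) g) ∧
    -- optimal plans
    (∀ s : ℝ≥0, 0 < s → ∀ π : Measure (X × X), EntropicOT.IsOptimalPlan c ε α β π →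
      EntropicOT.IsOptimalPlan c ε (s • α) (s • β) (s • π)) ∧
    -- all the costs involved are finite
    (∀ s : ℝ≥0, 0 < s →
      EntropicOT.primalValue c ε (s • α) (s • β) ≠ ∞ ∧
      EntropicOT.primalValue c ε (s • α) (s • α) ≠ ∞ ∧
      EntropicOT.primalValue c ε (s • β) (s • β) ≠ ∞) ∧
    -- scaling of the cost
    (∀ s : ℝ≥0, 0 < s →
      EntropicOT.cost c ε (s • α) (s • β) =
        s * EntropicOT.cost c ε α β + ε * s * (s - 1) * m ^ 2 - ε * Real.log s * s * m) ∧
    -- the cost is not homogeneous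
    (0 < m → ∃ s : ℝ≥0, 0 < s ∧
      EntropicOT.cost c ε (s • α) (s • β) ≠ s * EntropicOT.cost c ε α β) ∧
    -- the Sinkhorn divergence is homogeneous
    (∀ s : ℝ≥0, 0 < s →
      EntropicOT.sinkhornDivergence c ε (s • α) (s • β) =
        s * EntropicOT.sinkhornDivergence c ε α β) := by
  have : CompactSpace X := isCompact_iff_compactSpace.1 hX
  obtain ⟨K, hK⟩ := hc_lip
  -- A continuous cost on the compact `X × X` is bounded, which makes the normalized product plan
  -- have finite cost.
  obtain ⟨C, hC⟩ := (isCompact_range hK.continuous).bddAbove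
  have hbound : ∀ x y, c x y ≤ C := fun x y => hC ⟨(x, y), rfl⟩
  have hfin : ∀ μ ν : Measure X, IsFiniteMeasure μ → IsFiniteMeasure ν →
      μ.real Set.univ = m → ν.real Set.univ = m → ∀ s : ℝ≥0,
      EntropicOT.primalValue c ε (s • μ) (s • ν) ≠ ∞ := by
    intro μ ν _ _ hμ hν s
    refine EntropicOT.primalValue_ne_top c hbound (m := s * m) ?_ ?_
    · rw [measureReal_nnreal_smul_apply, hμ]
    · rw [measureReal_nnreal_smul_apply, hν]
  have hcost : ∀ μ ν : Measure X, IsFiniteMeasure μ → IsFiniteMeasure ν →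
      μ.real Set.univ = m → ν.real Set.univ = m → ∀ s : ℝ≥0, 0 < s →
      EntropicOT.cost c ε (s • μ) (s • ν) =
        s * EntropicOT.cost c ε μ ν + EntropicOT.scalingDefect ε m s := by
    intro μ ν _ _ hμ hν s hs
    exact EntropicOT.cost_smul c hε.le hs.ne' hμ hν
      (EntropicOT.primalValue_ne_top c hbound hμ hν)
  refine ⟨fun s hs f g h => h.smul hK.continuous hε.ne' hα hβ hs,
    fun s hs π h => h.smul c hε.le hs.ne' hα hβ,
    fun s _ => ⟨hfin α β ‹_› ‹_› hα hβ s, hfin α α ‹_› ‹_› hα hα s, hfin β β ‹_› ‹_› hβ hβ s⟩,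
    fun s hs => ?_, fun hm => ?_, fun s hs => ?_⟩
  · rw [hcost α β ‹_› ‹_› hα hβ s hs, EntropicOT.scalingDefect]
    ring
  · obtain ⟨s, hs, hne⟩ := EntropicOT.exists_scalingDefect_ne_zero hε hm
    refine ⟨s, hs, ?_⟩
    rw [hcost α β ‹_› ‹_› hα hβ s hs]
    simpa using hne
  · rw [EntropicOT.sinkhornDivergence, EntropicOT.sinkhornDivergence,
      hcost α β ‹_› ‹_› hα hβ s hs, hcost α α ‹_› ‹_› hα hα s hs, hcost β β ‹_› ‹_› hβ hβ s hs]
    ring
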